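/- \textbf{Theorem.} A \emph{$B$-term} is a term built from the single constant $B$ by binary application (written as juxtaposition, associating to the left). To each $B$-term corresponds the closed untyped $\lambda$-term obtained by replacing every occurrence of $B$ by $\lambda x.\lambda y.\lambda z.\,x\,(y\,z)$. Two $B$-terms are called $\beta\eta$-equivalent if their corresponding $\lambda$-terms are $\beta\eta$-equivalent, and an equality between $B$-terms is \emph{derivable} from a set of equations if it belongs to the least equivalence relation on $B$-terms that is compatible with application and contains all instances of the equations obtained by putting $B$-terms for the variables. Two $B$-terms $e_1$ and $e_2$ are $\beta\eta$-equivalent if and only if the equality $e_1=e_2$ is derivable from the equations \[ \begin{aligned} \text{(B1)}\quad & B\,x\,y\,z = x\,(y\,z),\\ \text{(B2)}\quad & B\,(B\,x\,y) = B\,(B\,x)\,(B\,y),\\ \text{(B3)}\quad & B\,B\,(B\,x) = B\,(B\,(B\,x))\,B. \end{aligned} \] -/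

import Mathlib

/-- Untyped lambda terms up to renaming of bound variables, in de Bruijn notation:
`var n` refers to the `n`-th enclosing abstraction, counted from the inside and from `0`
(or to a free variable if there are not enough abstractions). -/
inductive Lam : Type
  | var : ℕ → Lam
  | app : Lam → Lam → Lam
  | lam : Lam → Lam

namespace Lam

/-- Lifting a renaming of variables under an abstraction. -/
def liftRen (r : ℕ → ℕ) : ℕ → ℕ
  | 0 => 0
  | n + 1 => r n + 1

/-- Renaming of the free variables. -/
def rename : (ℕ → ℕ) → Lam → Lam
  | r, var n => var (r n)
  | r, app t u => app (rename r t) (rename r u)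
  | r, lam t => lam (rename (liftRen r) t)

/-- Weakening: all free variables are shifted by one. -/
def shift (t : Lam) : Lam := rename Nat.succ t

/-- Lifting a substitution under an abstraction. -/
def liftSub (s : ℕ → Lam) : ℕ → Lam
  | 0 => var 0
  | n + 1 => shift (s n)

/-- Simultaneous capture-avoiding substitution for all free variables. -/
def subst : (ℕ → Lam) → Lam → Lam
  | s, var n => s n
  | s, app t u => app (subst s t) (subst s u)
  | s, lam t => lam (subst (liftSub s) t)

/-- The substitution that puts `u` for the variable `0` and lowers all other variables by one. -/
def single (u : Lam) : ℕ → Lam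
  | 0 => u
  | n + 1 => var n

/-- The contractum `t[x := u]` of the beta-redex `(λ x. t) u`. -/
def inst (t u : Lam) : Lam := subst (single u) t

/-- `βη`-equivalence: the least congruence (also under abstractions) on lambda terms that
contains the rules beta, `(λ x. t) u = t[x := u]`, and eta, `λ x. t x = t` with `x` not
free in `t`. -/
inductive BetaEta : Lam → Lam → Prop
  | beta (t u : Lam) : BetaEta (app (lam t) u) (inst t u)
  | eta (t : Lam) : BetaEta (lam (app (shift t) (var 0))) t
  | refl (t : Lam) : BetaEta t t
  | symm {t u : Lam} : BetaEta t u → BetaEta u t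
  | trans {t u v : Lam} : BetaEta t u → BetaEta u v → BetaEta t v
  | app {t t' u u' : Lam} : BetaEta t t' → BetaEta u u' → BetaEta (app t u) (app t' u')
  | lam {t t' : Lam} : BetaEta t t' → BetaEta (lam t) (lam t')

end Lam

/-- `B`-terms: combinatory terms built from the combinator `B` alone by application. -/
inductive BTerm : Type
  | B : BTerm
  | app : BTerm → BTerm → BTerm

namespace BTerm

/-- The lambda term of a `B`-term; `B` stands for `λ x. λ y. λ z. x (y z)`. -/
def toLam : BTerm → Lam
  | B => .lam (.lam (.lam (.app (.var 2) (.app (.var 1) (.var 0)))))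
  | app e f => .app (toLam e) (toLam f)

/-- Two `B`-terms are equivalent if their lambda terms are `βη`-equivalent. -/
def Equivalent (e f : BTerm) : Prop := Lam.BetaEta (toLam e) (toLam f)

/-- Derivability of an equality between `B`-terms, in equational logic, from the equations
(B1) `B x y z = x (y z)`, (B2) `B (B x y) = B (B x) (B y)` and
(B3) `B B (B x) = B (B (B x)) B`. -/
inductive Derivable : BTerm → BTerm → Prop
  | B1 (x y z : BTerm) : Derivable (app (app (app B x) y) z) (app x (app y z))
  | B2 (x y : BTerm) :
      Derivable (app B (app (app B x) y)) (app (app B (app B x)) (app B y))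
  | B3 (x : BTerm) :
      Derivable (app (app B B) (app B x)) (app (app B (app B (app B x))) B)
  | refl (e : BTerm) : Derivable e e
  | symm {e f : BTerm} : Derivable e f → Derivable f e
  | trans {e f g : BTerm} : Derivable e f → Derivable f g → Derivable e g
  | app {e e' f f' : BTerm} : Derivable e e' → Derivable f f' → Derivable (app e f) (app e' f')

end BTerm

namespace Lam

/-! ### Renaming and substitution -/

/-! Soundness: by η it suffices to compare both sides of each equation on enough arguments, where
`BetaEta.B_app` computes.

Completeness rests on normal forms. Read `B x y` as composition. (B1) and (B2) make it associative,
(B2) makes `B` distribute over it, and (B3) gives the exchange law `mono_comm`. Hence every term is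
derivably a composition of `mono k` with weakly decreasing `k` (`hasNormalForm`).

Distinct normal forms are not equivalent: on a head and a long argument sequence, `mono n` replaces
arguments `n` and `n + 1` by the application of the first to the second. Fed with variables, a
normal form reduces to an abstraction-free term from which its list of indices can be read off
(`mergeList_var_injective`). Such terms are βη-normal, so by Church–Rosser equivalent ones are
equal. Church–Rosser follows from the diamond property of parallel reduction. -/

theorem liftRen_comp (r q : ℕ → ℕ) : liftRen r ∘ liftRen q = liftRen (r ∘ q) := by
  funext i; cases i <;> rfl

theorem rename_rename (r q : ℕ → ℕ) (t : Lam) : rename r (rename q t) = rename (r ∘ q) t := by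
  induction t generalizing r q with
  | var n => rfl
  | app t u iht ihu => simp [rename, iht, ihu]
  | lam t ih => simp [rename, ih, liftRen_comp]

theorem rename_shift (r : ℕ → ℕ) (t : Lam) :
    rename (liftRen r) (shift t) = shift (rename r t) := by
  simp only [shift, rename_rename]; rfl

theorem liftSub_comp_liftRen (s : ℕ → Lam) (r : ℕ → ℕ) :
    liftSub s ∘ liftRen r = liftSub (s ∘ r) := by
  funext i; cases i <;> rfl

theorem subst_rename (s : ℕ → Lam) (r : ℕ → ℕ) (t : Lam) :
    subst s (rename r t) = subst (s ∘ r) t := by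
  induction t generalizing s r with
  | var n => rfl
  | app t u iht ihu => simp [rename, subst, iht, ihu]
  | lam t ih => simp [rename, subst, ih, liftSub_comp_liftRen]

theorem rename_comp_liftSub (r : ℕ → ℕ) (s : ℕ → Lam) :
    rename (liftRen r) ∘ liftSub s = liftSub (rename r ∘ s) := by
  funext i
  cases i with
  | zero => rfl
  | succ i => exact rename_shift r (s i)

theorem rename_subst (r : ℕ → ℕ) (s : ℕ → Lam) (t : Lam) :
    rename r (subst s t) = subst (rename r ∘ s) t := by
  induction t generalizing s r with
  | var n => rfl
  | app t u iht ihu => simp [rename, subst, iht, ihu]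
  | lam t ih => simp [rename, subst, ih, rename_comp_liftSub]

theorem subst_shift (s : ℕ → Lam) (t : Lam) :
    subst (liftSub s) (shift t) = shift (subst s t) := by
  simp only [shift, subst_rename, rename_subst]; rfl

theorem subst_comp_liftSub (s p : ℕ → Lam) :
    subst (liftSub s) ∘ liftSub p = liftSub (subst s ∘ p) := by
  funext i
  cases i with
  | zero => rfl
  | succ i => exact subst_shift s (p i)

theorem subst_subst (s p : ℕ → Lam) (t : Lam) : subst s (subst p t) = subst (subst s ∘ p) t := by
  induction t generalizing s p with
  | var n => rfl
  | app t u iht ihu => simp [subst, iht, ihu]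
  | lam t ih => simp [subst, ih, subst_comp_liftSub]

theorem liftSub_var : liftSub var = var := by
  funext i; cases i <;> rfl

theorem subst_var (t : Lam) : subst var t = t := by
  induction t with
  | var n => rfl
  | app t u iht ihu => simp [subst, iht, ihu]
  | lam t ih => simp [subst, ih, liftSub_var]

theorem inst_shift (t u : Lam) : inst (shift t) u = t := by
  simp only [inst, shift, subst_rename]
  exact subst_var t

theorem shift_injective : Function.Injective shift := fun t u h => by
  rw [← inst_shift t (var 0), h, inst_shift]

theorem inst_rename_liftRen_succ (t : Lam) : inst (rename (liftRen Nat.succ) t) (var 0) = t := by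
  rw [inst, subst_rename]
  convert subst_var t using 2
  funext i; cases i <;> rfl

theorem rename_inst (r : ℕ → ℕ) (t u : Lam) :
    rename r (inst t u) = inst (rename (liftRen r) t) (rename r u) := by
  simp only [inst, subst_rename, rename_subst]
  congr 1; funext i; cases i <;> rfl

theorem subst_inst (s : ℕ → Lam) (t u : Lam) :
    subst s (inst t u) = inst (subst (liftSub s) t) (subst s u) := by
  simp only [inst, subst_subst]
  congr 1; funext i
  cases i with
  | zero => rfl
  | succ i => exact (inst_shift (s i) _).symm

/-- Renaming turns pullback squares of functions into weak pullback squares. -/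
theorem exists_of_rename_eq_rename {f g p q : ℕ → ℕ}
    (h : ∀ i j, f i = g j → ∃ k, i = p k ∧ j = q k) {t u : Lam}
    (e : rename f t = rename g u) : ∃ w, t = rename p w ∧ u = rename q w := by
  induction t generalizing f g p q u with
  | var n =>
    cases u with
    | var m =>
      obtain ⟨k, rfl, rfl⟩ := h n m (by simpa [rename] using e)
      exact ⟨var k, rfl, rfl⟩
    | app _ _ => simp [rename] at e
    | lam _ => simp [rename] at e
  | app t₁ t₂ ih₁ ih₂ =>
    cases u with
    | var m => simp [rename] at e
    | app u₁ u₂ =>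
      simp only [rename, app.injEq] at e
      obtain ⟨w₁, rfl, rfl⟩ := ih₁ h e.1
      obtain ⟨w₂, rfl, rfl⟩ := ih₂ h e.2
      exact ⟨app w₁ w₂, rfl, rfl⟩
    | lam _ => simp [rename] at e
  | lam t ih =>
    cases u with
    | var m => simp [rename] at e
    | app _ _ => simp [rename] at e
    | lam u =>
      simp only [rename, lam.injEq] at e
      have h' : ∀ i j, liftRen f i = liftRen g j → ∃ k, i = liftRen p k ∧ j = liftRen q k := by
        intro i j hij
        cases i <;> cases j <;> simp only [liftRen, Nat.add_right_cancel_iff] at hij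
        · exact ⟨0, rfl, rfl⟩
        · omega
        · omega
        · obtain ⟨k, rfl, rfl⟩ := h _ _ hij
          exact ⟨k + 1, rfl, rfl⟩
      obtain ⟨w, rfl, rfl⟩ := ih h' e
      exact ⟨lam w, rfl, rfl⟩

/-! ### Parallel reduction and the Church–Rosser theorem -/

/-- Parallel `βη`-reduction. -/
inductive Par : Lam → Lam → Prop
  | var (n : ℕ) : Par (var n) (var n)
  | app {t t' u u' : Lam} : Par t t' → Par u u' → Par (app t u) (app t' u')
  | lam {t t' : Lam} : Par t t' → Par (lam t) (lam t')
  | beta {t t' u u' : Lam} : Par t t' → Par u u' → Par (app (lam t) u) (inst t' u')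
  | eta {t t' : Lam} : Par t t' → Par (lam (app (shift t) (var 0))) t'

theorem Par.refl (t : Lam) : Par t t := by
  induction t with
  | var n => exact .var n
  | app _ _ iht ihu => exact .app iht ihu
  | lam _ ih => exact .lam ih

theorem Par.rename {t t' : Lam} (h : Par t t') (r : ℕ → ℕ) :
    Par (rename r t) (rename r t') := by
  induction h generalizing r with
  | var n => exact .var _
  | app _ _ iht ihu => exact .app (iht r) (ihu r)
  | lam _ ih => exact .lam (ih _)
  | beta _ _ iht ihu => rw [rename_inst]; exact .beta (iht _) (ihu r)
  | eta _ ih =>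
    simp only [Lam.rename, rename_shift]
    exact .eta (ih r)

theorem Par.liftSub {s s' : ℕ → Lam} (h : ∀ i, Par (s i) (s' i)) (i : ℕ) :
    Par (liftSub s i) (liftSub s' i) := by
  cases i with
  | zero => exact .var 0
  | succ i => exact (h i).rename _

theorem Par.subst {t t' : Lam} (h : Par t t') {s s' : ℕ → Lam} (hs : ∀ i, Par (s i) (s' i)) :
    Par (subst s t) (subst s' t') := by
  induction h generalizing s s' with
  | var n => exact hs n
  | app _ _ iht ihu => exact .app (iht hs) (ihu hs)
  | lam _ ih => exact .lam (ih (Par.liftSub hs))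
  | beta _ _ iht ihu => rw [subst_inst]; exact .beta (iht (Par.liftSub hs)) (ihu hs)
  | eta _ ih =>
    simp only [Lam.subst, subst_shift]
    exact .eta (ih hs)

theorem Par.inst {t t' u u' : Lam} (ht : Par t t') (hu : Par u u') :
    Par (inst t u) (inst t' u') :=
  ht.subst fun i => by
    cases i with
    | zero => exact hu
    | succ i => exact .var i

/-- Renaming creates no redexes, so reductions pull back along it. For `r = Nat.succ` this handles
the function part of an η-redex. -/
theorem Par.exists_of_rename {r : ℕ → ℕ} {t s : Lam} (h : Par (Lam.rename r t) s) :
    ∃ s', Par t s' ∧ s = Lam.rename r s' := by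
  generalize e : Lam.rename r t = t₀ at h
  induction h generalizing r t with
  | var n => exact ⟨t, .refl t, e.symm⟩
  | app _ _ iht ihu =>
    cases t <;> simp only [Lam.rename, app.injEq, reduceCtorEq] at e
    obtain ⟨a, ha, rfl⟩ := iht e.1
    obtain ⟨b, hb, rfl⟩ := ihu e.2
    exact ⟨_, .app ha hb, rfl⟩
  | lam _ ih =>
    cases t <;> simp only [Lam.rename, lam.injEq, reduceCtorEq] at e
    obtain ⟨a, ha, rfl⟩ := ih e
    exact ⟨_, .lam ha, rfl⟩
  | beta _ _ iht ihu =>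
    cases t with
    | app t u =>
      cases t <;> simp only [Lam.rename, app.injEq, lam.injEq, reduceCtorEq, false_and] at e
      obtain ⟨a, ha, rfl⟩ := iht e.1
      obtain ⟨b, hb, rfl⟩ := ihu e.2
      exact ⟨_, .beta ha hb, (rename_inst _ _ _).symm⟩
    | _ => simp [Lam.rename] at e
  | @eta v v' _ ih =>
    cases t with
    | lam t =>
      cases t with
      | app a b =>
        simp only [Lam.rename, lam.injEq, app.injEq] at e
        -- This pullback square shows that the η-redex was already one before renaming.
        have h' : ∀ i j, liftRen r i = Nat.succ j → ∃ k, i = Nat.succ k ∧ j = r k := by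
          intro i j hij
          cases i with
          | zero => simp [liftRen] at hij
          | succ i => exact ⟨i, rfl, by simpa [liftRen] using hij.symm⟩
        obtain ⟨w, rfl, rfl⟩ := exists_of_rename_eq_rename h' e.1
        cases b with
        | var k =>
          cases k with
          | zero =>
            obtain ⟨c, hc, rfl⟩ := ih rfl
            exact ⟨c, .eta hc, rfl⟩
          | succ k => simp [Lam.rename, liftRen] at e
        | _ => simp [Lam.rename] at e
      | _ => simp [Lam.rename] at e
    | _ => simp [Lam.rename] at e

/-- The parallel reducts of the body of an `η`-redex. -/
theorem Par.app_shift_var {v c : Lam} (h : Par (Lam.app (shift v) (Lam.var 0)) c) :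
    (∃ w, Par v w ∧ c = Lam.app (shift w) (Lam.var 0)) ∨ ∃ s, v = Lam.lam s ∧ Par s c := by
  generalize e : shift v = v₀ at h
  cases h with
  | app ha hb =>
    subst e
    cases hb
    obtain ⟨w, hw, rfl⟩ := ha.exists_of_rename
    exact .inl ⟨w, hw, rfl⟩
  | beta ha hb =>
    cases hb
    cases v <;> simp only [shift, Lam.rename, lam.injEq, reduceCtorEq] at e
    subst e
    obtain ⟨w, hw, rfl⟩ := ha.exists_of_rename
    rw [inst_rename_liftRen_succ]
    exact .inr ⟨_, rfl, hw⟩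

/-- The number of constructors of a term. -/
def size : Lam → ℕ
  | var _ => 1
  | app t u => size t + size u + 1
  | lam t => size t + 1

theorem size_rename (r : ℕ → ℕ) (t : Lam) : size (rename r t) = size t := by
  induction t generalizing r with
  | var n => rfl
  | app t u iht ihu => simp [rename, size, iht, ihu]
  | lam t ih => simp [rename, size, ih]

theorem size_shift (t : Lam) : size (shift t) = size t := size_rename _ t

/-- The induction step of the diamond property for a redex contracted on one side only. -/
theorem Par.diamond_app_beta {c b a₁ b₁ c₂ b₂ : Lam}
    (ih : ∀ t, size t < size (Lam.app (Lam.lam c) b) → ∀ t₁ t₂, Par t t₁ → Par t t₂ →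
      ∃ d, Par t₁ d ∧ Par t₂ d)
    (ha : Par (Lam.lam c) a₁) (hb₁ : Par b b₁) (hc : Par c c₂) (hb₂ : Par b b₂) :
    ∃ d, Par (Lam.app a₁ b₁) d ∧ Par (Lam.inst c₂ b₂) d := by
  obtain ⟨y, hy₁, hy₂⟩ := ih b (by simp only [size]; omega) _ _ hb₁ hb₂
  cases ha with
  | lam hc₁ =>
    obtain ⟨x, hx₁, hx₂⟩ := ih c (by simp only [size]; omega) _ _ hc₁ hc
    exact ⟨_, .beta hx₁ hy₁, hx₂.inst hy₂⟩
  | @eta v _ hv =>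
    obtain ⟨w, hw, rfl⟩ | ⟨s, rfl, hs⟩ := hc.app_shift_var
    · obtain ⟨x, hx₁, hx₂⟩ := ih v (by simp only [size, size_shift]; omega) _ _ hv hw
      refine ⟨_, .app hx₁ hy₁, ?_⟩
      change Par (Lam.app (Lam.inst (shift w) b₂) b₂) _
      rw [inst_shift]
      exact .app hx₂ hy₂
    -- Both sides are reducts of this smaller redex. It need not be a subterm of the original, hence
    -- the induction on size.
    · exact ih (Lam.app (Lam.lam s) b) (by simp only [size, size_shift]; omega) _ _
        (.app hv hb₁) (.beta hs hb₂)

/-- The induction step of the diamond property for an `η`-redex contracted on one side only. -/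
theorem Par.diamond_lam_eta {v c v' : Lam}
    (ih : ∀ t₁ t₂, Par v t₁ → Par v t₂ → ∃ d, Par t₁ d ∧ Par t₂ d)
    (hc : Par (Lam.app (shift v) (Lam.var 0)) c) (hv : Par v v') :
    ∃ d, Par (Lam.lam c) d ∧ Par v' d := by
  obtain ⟨w, hw, rfl⟩ | ⟨s, rfl, hs⟩ := hc.app_shift_var
  · obtain ⟨x, hx₁, hx₂⟩ := ih _ _ hw hv
    exact ⟨x, .eta hx₁, hx₂⟩
  · exact ih _ _ (.lam hs) hv

theorem Par.diamond (t t₁ t₂ : Lam) (h₁ : Par t t₁) (h₂ : Par t t₂) :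
    ∃ d, Par t₁ d ∧ Par t₂ d := by
  induction hn : size t using Nat.strong_induction_on generalizing t t₁ t₂ with
  | _ n ih' =>
  have ih : ∀ u, size u < size t → ∀ u₁ u₂, Par u u₁ → Par u u₂ → ∃ d, Par u₁ d ∧ Par u₂ d :=
    fun u hu u₁ u₂ h₁ h₂ => ih' _ (hn ▸ hu) u u₁ u₂ h₁ h₂ rfl
  clear ih' hn
  cases h₁ with
  | var n => exact ⟨t₂, h₂, .refl t₂⟩
  | app ha hb =>
    cases h₂ with
    | app ha' hb' =>
      obtain ⟨x, hx₁, hx₂⟩ := ih _ (by simp only [size]; omega) _ _ ha ha'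
      obtain ⟨y, hy₁, hy₂⟩ := ih _ (by simp only [size]; omega) _ _ hb hb'
      exact ⟨_, .app hx₁ hy₁, .app hx₂ hy₂⟩
    | beta hc hb' => exact Par.diamond_app_beta ih ha hb hc hb'
  | beta hc hb =>
    cases h₂ with
    | app ha' hb' =>
      obtain ⟨d, h₁, h₂⟩ := Par.diamond_app_beta ih ha' hb' hc hb
      exact ⟨d, h₂, h₁⟩
    | beta hc' hb' =>
      obtain ⟨x, hx₁, hx₂⟩ := ih _ (by simp only [size]; omega) _ _ hc hc'
      obtain ⟨y, hy₁, hy₂⟩ := ih _ (by simp only [size]; omega) _ _ hb hb'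
      exact ⟨_, hx₁.inst hy₁, hx₂.inst hy₂⟩
  | lam hc =>
    generalize e : Lam.lam _ = t at h₂ ih
    cases h₂ with
    | lam hc' =>
      cases e
      obtain ⟨x, hx₁, hx₂⟩ := ih _ (by simp only [size]; omega) _ _ hc hc'
      exact ⟨_, .lam hx₁, .lam hx₂⟩
    | eta hv =>
      cases e
      exact Par.diamond_lam_eta (ih _ (by simp only [size, size_shift]; omega)) hc hv
    | _ => cases e
  | @eta v _ hv =>
    have ihv := ih v (by simp only [size, size_shift]; omega)
    generalize e : Lam.lam (Lam.app (shift v) (Lam.var 0)) = t at h₂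
    cases h₂ with
    | lam hc =>
      cases e
      obtain ⟨d, h₁, h₂⟩ := Par.diamond_lam_eta ihv hc hv
      exact ⟨d, h₂, h₁⟩
    | eta hv' =>
      simp only [lam.injEq, app.injEq, and_true] at e
      cases shift_injective e
      exact ihv _ _ hv hv'
    | _ => cases e

open Relation in
/-- The Church–Rosser theorem for `βη`-equivalence. -/
theorem BetaEta.join {t u : Lam} (h : BetaEta t u) : Join (ReflTransGen Par) t u := by
  have eqv : Equivalence (Join (ReflTransGen Par)) :=
    equivalence_join_reflTransGen fun a b c hb hc =>
      let ⟨d, h₁, h₂⟩ := Par.diamond a b c hb hc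
      ⟨d, .single h₁, .single h₂⟩
  have of_par {t u : Lam} (h : Par t u) : Join (ReflTransGen Par) t u := ⟨u, .single h, .refl⟩
  induction h with
  | beta t u => exact of_par (.beta (.refl t) (.refl u))
  | eta t => exact of_par (.eta (.refl t))
  | refl t => exact eqv.refl t
  | symm _ ih => exact eqv.symm ih
  | trans _ _ ih₁ ih₂ => exact eqv.trans ih₁ ih₂
  | app _ _ ih₁ ih₂ =>
    obtain ⟨a, h₁, h₂⟩ := ih₁
    obtain ⟨b, h₃, h₄⟩ := ih₂
    have key {t a u b : Lam} (h : ReflTransGen Par t a) (h' : ReflTransGen Par u b) :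
        ReflTransGen Par (Lam.app t u) (Lam.app a b) :=
      (h.lift (fun x => Lam.app x u) fun _ _ hx => .app hx (.refl u)).trans
        (h'.lift (Lam.app a) fun _ _ hx => .app (.refl a) hx)
    exact ⟨_, key h₁ h₃, key h₂ h₄⟩
  | lam _ ih =>
    obtain ⟨a, h₁, h₂⟩ := ih
    exact ⟨_, h₁.lift Lam.lam fun _ _ => .lam, h₂.lift Lam.lam fun _ _ => .lam⟩

/-- Terms without abstractions. -/
def Free : Lam → Prop
  | var _ => True
  | app t u => Free t ∧ Free u
  | lam _ => False

/-- β- and η-redexes both contain an abstraction. -/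
theorem Free.eq_of_par {t u : Lam} (ht : Free t) (h : Par t u) : t = u := by
  induction h with
  | var n => rfl
  | app _ _ ih₁ ih₂ => rw [ih₁ ht.1, ih₂ ht.2]
  | beta => exact ht.1.elim
  | lam => exact ht.elim
  | eta => exact ht.elim

theorem Free.eq_of_reflTransGen {t u : Lam} (ht : Free t)
    (h : Relation.ReflTransGen Par t u) : t = u := by
  induction h with
  | refl => rfl
  | tail _ h ih => subst ih; exact ht.eq_of_par h

theorem BetaEta.eq_of_free {t u : Lam} (h : BetaEta t u) (ht : Free t) (hu : Free u) : t = u := by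
  obtain ⟨a, h₁, h₂⟩ := h.join
  rw [ht.eq_of_reflTransGen h₁, hu.eq_of_reflTransGen h₂]

/-! ### The combinator `B` in the lambda calculus -/

theorem BetaEta.ext {t u : Lam}
    (h : BetaEta (Lam.app (shift t) (var 0)) (Lam.app (shift u) (var 0))) : BetaEta t u :=
  (BetaEta.eta t).symm.trans (h.lam.trans (.eta u))

theorem BetaEta.B_app (x y z : Lam) :
    BetaEta (Lam.app (Lam.app (Lam.app BTerm.B.toLam x) y) z) (Lam.app x (Lam.app y z)) := by
  have h₁ := BetaEta.beta (.lam (.lam (.app (.var 2) (.app (.var 1) (.var 0))))) x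
  have h₂ := BetaEta.beta (.lam (.app (shift (shift x)) (.app (.var 1) (.var 0)))) y
  have h₃ := BetaEta.beta (.app (shift x) (.app (shift y) (.var 0))) z
  have e₂ : inst (.lam (.app (shift (shift x)) (.app (.var 1) (.var 0)))) y
      = .lam (.app (shift x) (.app (shift y) (.var 0))) := by
    simp only [inst, subst, subst_shift, liftSub, single]
    rw [← inst, inst_shift]
  have e₃ : inst (.app (shift x) (.app (shift y) (.var 0))) z = .app x (.app y z) := by
    change Lam.app (inst (shift x) z) (Lam.app (inst (shift y) z) z) = _
    rw [inst_shift, inst_shift]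
  rw [e₂] at h₂
  rw [e₃] at h₃
  exact (((h₁.app (.refl y)).trans h₂).app (.refl z)).trans h₃

/-! ### Argument sequences and merging -/

/-- `t` applied to the first `N` terms of the sequence `s`. -/
def spine (t : Lam) (s : ℕ → Lam) : ℕ → Lam
  | 0 => t
  | N + 1 => app (spine t s N) (s N)

theorem spine_congr {t u : Lam} (h : BetaEta t u) (s : ℕ → Lam) (N : ℕ) :
    BetaEta (spine t s N) (spine u s N) := by
  induction N with
  | zero => exact h
  | succ N ih => exact ih.app (.refl _)

theorem spine_congr_seq (t : Lam) {s s' : ℕ → Lam} {N : ℕ} (h : ∀ i < N, s i = s' i) :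
    spine t s N = spine t s' N := by
  induction N with
  | zero => rfl
  | succ N ih => rw [spine, spine, ih fun i hi => h i (by omega), h N (by omega)]

theorem spine_free {t : Lam} (ht : Free t) {s : ℕ → Lam} (hs : ∀ i, Free (s i)) (N : ℕ) :
    Free (spine t s N) := by
  induction N with
  | zero => exact ht
  | succ N ih => exact ⟨ih, hs N⟩

theorem spine_var_injective {k : ℕ} {s s' : ℕ → Lam} {N N' : ℕ}
    (h : spine (var k) s N = spine (var k) s' N') : N = N' ∧ ∀ i < N, s i = s' i := by
  induction N generalizing N' with
  | zero =>
    cases N' with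
    | zero => simp
    | succ N' => cases h
  | succ N ih =>
    cases N' with
    | zero => cases h
    | succ N' =>
      simp only [spine, app.injEq] at h
      obtain ⟨rfl, h'⟩ := ih h.1
      refine ⟨rfl, fun i hi => ?_⟩
      obtain hi | rfl := Nat.lt_succ_iff_lt_or_eq.1 hi
      · exact h' i hi
      · exact h.2

/-- The sequence obtained by applying the `n`-th term to its successor. -/
def merge (n : ℕ) (s : ℕ → Lam) (i : ℕ) : Lam :=
  if i < n then s i else if i = n then app (s n) (s (n + 1)) else s (i + 1)

theorem merge_of_lt {n i : ℕ} (h : i < n) (s : ℕ → Lam) : merge n s i = s i := if_pos h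

theorem merge_self (n : ℕ) (s : ℕ → Lam) : merge n s n = app (s n) (s (n + 1)) := by
  simp [merge]

theorem merge_of_gt {n i : ℕ} (h : n < i) (s : ℕ → Lam) : merge n s i = s (i + 1) := by
  rw [merge, if_neg (by omega), if_neg (by omega)]

theorem merge_injective (n : ℕ) : Function.Injective (merge n) := fun s s' h => by
  have hn := congrFun h n
  rw [merge_self, merge_self, app.injEq] at hn
  funext i
  obtain hi | rfl | rfl | hi : i < n ∨ i = n ∨ i = n + 1 ∨ n + 1 < i := by omega
  · rw [← merge_of_lt hi s, h, merge_of_lt hi]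
  · exact hn.1
  · exact hn.2
  · obtain ⟨j, rfl⟩ : ∃ j, i = j + 1 := ⟨i - 1, by omega⟩
    rw [← merge_of_gt (show n < j by omega) s, h, merge_of_gt (by omega)]

theorem merge_free {n : ℕ} {s : ℕ → Lam} (hs : ∀ i, Free (s i)) (i : ℕ) : Free (merge n s i) := by
  unfold merge
  split_ifs
  exacts [hs _, ⟨hs _, hs _⟩, hs _]

/-- Successive merging at the positions in a list. -/
def mergeList : List ℕ → (ℕ → Lam) → ℕ → Lam
  | [], s => s
  | n :: l, s => mergeList l (merge n s)

theorem mergeList_free (l : List ℕ) {s : ℕ → Lam} (hs : ∀ i, Free (s i)) (i : ℕ) :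
    Free (mergeList l s i) := by
  induction l generalizing s with
  | nil => exact hs i
  | cons n l ih => exact ih (merge_free hs)

theorem mergeList_concat (l : List ℕ) (m : ℕ) (s : ℕ → Lam) :
    mergeList (l ++ [m]) s = merge m (mergeList l s) := by
  induction l generalizing s with
  | nil => rfl
  | cons n l ih => exact ih _

theorem mergeList_of_lt {l : List ℕ} {i : ℕ} (h : ∀ n ∈ l, i < n) (s : ℕ → Lam) :
    mergeList l s i = s i := by
  induction l generalizing s with
  | nil => rfl
  | cons n l ih =>
    rw [mergeList, ih fun k hk => h k (List.mem_cons_of_mem _ hk), merge_of_lt (h n (by simp))]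

/-- A decreasing list is determined by its merge of the sequence of variables. -/
theorem mergeList_var_injective {l l' : List ℕ} (hl : l.Pairwise (· ≥ ·))
    (hl' : l'.Pairwise (· ≥ ·)) (h : mergeList l var = mergeList l' var) : l = l' := by
  -- Position `m` holds an application on the left, but still a variable on the right. So the least
  -- index, merged last, is determined, and `merge_injective` cancels it.
  have key (a b : List ℕ) (m : ℕ) (hb : ∀ n ∈ b, m < n) :
      mergeList (a ++ [m]) var ≠ mergeList b var := fun e => by
    have := congrFun e m
    rw [mergeList_concat, merge_self, mergeList_of_lt hb] at this
    cases this
  have last {a : List ℕ} {m k : ℕ} (ha : (a ++ [m]).Pairwise (· ≥ ·)) (hk : k < m) :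
      ∀ n ∈ a ++ [m], k < n := by
    intro n hn
    rw [List.pairwise_append] at ha
    rw [List.mem_append, List.mem_singleton] at hn
    obtain hn | rfl := hn
    · exact hk.trans_le (ha.2.2 n hn m (by simp))
    · exact hk
  induction l using List.reverseRecOn generalizing l' with
  | nil =>
    obtain rfl | ⟨a, m, rfl⟩ := l'.eq_nil_or_concat'
    · rfl
    · exact (key a [] m (by simp) h.symm).elim
  | append_singleton l m ih =>
    obtain rfl | ⟨a, m', rfl⟩ := l'.eq_nil_or_concat'
    · exact (key l [] m (by simp) h).elim
    · obtain hm | rfl | hm := lt_trichotomy m m'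
      · exact (key _ _ _ (last hl' hm) h).elim
      · rw [mergeList_concat, mergeList_concat] at h
        rw [ih (List.pairwise_append.1 hl).1 (List.pairwise_append.1 hl').1 (merge_injective m h)]
      · exact (key _ _ _ (last hl hm) h.symm).elim

end Lam

namespace BTerm

/-! ### Normal forms of `B`-terms -/

/-- The composition `B x y` of two terms. -/
abbrev comp (x y : BTerm) : BTerm := app (app B x) y

/-- The term `B (B (⋯ (B B)))` with `n + 1` occurrences of `B`. -/
def mono : ℕ → BTerm
  | 0 => B
  | n + 1 => app B (mono n)

/-- The composition of the terms `mono k` for `k` in the list `n :: l`. -/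
def poly : ℕ → List ℕ → BTerm
  | n, [] => mono n
  | n, m :: l => comp (mono n) (poly m l)

theorem Derivable.comp_congr {x x' y y' : BTerm} (hx : Derivable x x') (hy : Derivable y y') :
    Derivable (comp x y) (comp x' y') := Derivable.app (.app (.refl B) hx) hy

theorem Derivable.comp_assoc (x y z : BTerm) :
    Derivable (comp (comp x y) z) (comp x (comp y z)) :=
  (Derivable.app (.B2 x y) (.refl z)).trans (.B1 (BTerm.app B x) (BTerm.app B y) z)

/-- (B3) is the case `m = 0`; applying `B` to both sides and distributing by (B2) raises both
indices. -/
theorem Derivable.mono_comm {m n : ℕ} (h : m < n) :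
    Derivable (comp (mono m) (mono n)) (comp (mono (n + 1)) (mono m)) := by
  induction m generalizing n with
  | zero =>
    obtain ⟨k, rfl⟩ : ∃ k, n = k + 1 := ⟨n - 1, by omega⟩
    exact .B3 (mono k)
  | succ m ih =>
    obtain ⟨k, rfl⟩ : ∃ k, n = k + 1 := ⟨n - 1, by omega⟩
    exact (Derivable.B2 _ _).symm.trans
      ((Derivable.app (.refl B) (ih (by omega : m < k))).trans (.B2 _ _))

/-- Insertion of `m` into a sorted list, where each index passed grows by one. The bound on `n'`
keeps the result decreasing in the induction. -/
theorem exists_poly_comp_mono (m n : ℕ) (l : List ℕ) (hl : (n :: l).Pairwise (· ≥ ·)) :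
    ∃ n' l', (n' :: l').Pairwise (· ≥ ·) ∧ n' ≤ max m (n + 1) ∧
      Derivable (comp (mono m) (poly n l)) (poly n' l') := by
  induction l generalizing n with
  | nil =>
    by_cases h : m < n
    · exact ⟨n + 1, [m], by simp; omega, by omega, .mono_comm h⟩
    · exact ⟨m, [n], by simp; omega, by omega, .refl _⟩
  | cons k l ih =>
    have hk : k ≤ n := by simp at hl; exact hl.1.1
    by_cases h : m < n
    · obtain ⟨n', l', hs, hn', hd⟩ := ih k (List.pairwise_cons.1 hl).2
      have hle : n' ≤ n + 1 := by omega
      refine ⟨n + 1, n' :: l', ?_, by omega, ?_⟩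
      · refine List.pairwise_cons.2 ⟨fun a ha => ?_, hs⟩
        obtain rfl | ha := List.mem_cons.1 ha
        · exact hle
        · exact ((List.pairwise_cons.1 hs).1 a ha).trans hle
      · exact (Derivable.comp_assoc _ _ _).symm.trans
          (((Derivable.mono_comm h).comp_congr (.refl _)).trans
            ((Derivable.comp_assoc _ _ _).trans (.comp_congr (.refl _) hd)))
    · refine ⟨m, n :: k :: l, ?_, by omega, .refl _⟩
      refine List.pairwise_cons.2 ⟨fun a ha => ?_, hl⟩
      obtain rfl | ha := List.mem_cons.1 ha
      · omega
      · exact ((List.pairwise_cons.1 hl).1 a ha).trans (by omega)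

theorem Derivable.B_poly (n : ℕ) (l : List ℕ) :
    Derivable (.app B (poly n l)) (poly (n + 1) (l.map (· + 1))) := by
  induction l generalizing n with
  | nil => exact .refl _
  | cons m l ih => exact (Derivable.B2 _ _).trans (.comp_congr (.refl _) (ih m))

/-- Being derivably equal to a composition of the terms `mono k` with decreasing `k`. -/
def HasNormalForm (e : BTerm) : Prop :=
  ∃ n l, (n :: l).Pairwise (· ≥ ·) ∧ Derivable e (poly n l)

theorem HasNormalForm.of_derivable {e f : BTerm} (hf : HasNormalForm f) (h : Derivable e f) :
    HasNormalForm e :=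
  let ⟨n, l, hl, hd⟩ := hf
  ⟨n, l, hl, h.trans hd⟩

theorem HasNormalForm.mono_app {e : BTerm} (he : HasNormalForm e) (n : ℕ) :
    HasNormalForm (.app (mono n) e) := by
  obtain ⟨k, l, hl, hd⟩ := he
  cases n with
  | zero =>
    refine ⟨k + 1, l.map (· + 1), ?_, (Derivable.app (.refl B) hd).trans (.B_poly k l)⟩
    rw [← List.map_cons (f := (· + 1)), List.pairwise_map]
    exact hl.imp fun h => by omega
  | succ n =>
    -- `mono (n + 1)` applied to `e` is, by definition, `comp (mono n) e`.
    obtain ⟨n', l', hs, -, hd'⟩ := exists_poly_comp_mono n k l hl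
    exact ⟨n', l', hs, (Derivable.comp_congr (.refl _) hd).trans hd'⟩

theorem HasNormalForm.poly_app {e : BTerm} (he : HasNormalForm e) (n : ℕ) (l : List ℕ) :
    HasNormalForm (.app (poly n l) e) := by
  induction l generalizing n with
  | nil => exact he.mono_app n
  | cons m l ih => exact ((ih m).mono_app n).of_derivable (.B1 _ _ _)

theorem hasNormalForm (e : BTerm) : HasNormalForm e := by
  induction e with
  | B => exact ⟨0, [], by simp, .refl B⟩
  | app e f ihe ihf =>
    obtain ⟨n, l, -, hd⟩ := ihe
    exact (ihf.poly_app n l).of_derivable (.app hd (.refl f))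

/-! ### Soundness and completeness -/

open Lam in
theorem toLam_rename (e : BTerm) (r : ℕ → ℕ) : rename r e.toLam = e.toLam := by
  induction e with
  | B => rfl
  | app e f ihe ihf => simp [toLam, rename, ihe, ihf]

open Lam in
theorem Equivalent.ext {e f : BTerm}
    (h : ∀ a, BetaEta (.app e.toLam a) (.app f.toLam a)) : Equivalent e f :=
  BetaEta.ext (by simpa only [shift, toLam_rename] using h (var 0))

open Lam in
theorem Equivalent.ext₂ {e f : BTerm}
    (h : ∀ a b, BetaEta (.app (.app e.toLam a) b) (.app (.app f.toLam a) b)) :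
    Equivalent e f :=
  .ext fun a => BetaEta.ext (by
    simpa only [shift, Lam.rename, toLam_rename] using h (shift a) (var 0))

open Lam in
theorem Equivalent.ext₃ {e f : BTerm}
    (h : ∀ a b c, BetaEta (.app (.app (.app e.toLam a) b) c) (.app (.app (.app f.toLam a) b) c)) :
    Equivalent e f :=
  .ext₂ fun a b => BetaEta.ext (by
    simpa only [shift, Lam.rename, toLam_rename] using h (shift a) (shift b) (var 0))

open Lam in
theorem Derivable.equivalent {e f : BTerm} (h : Derivable e f) : Equivalent e f := by
  induction h with
  | B1 x y z => exact .B_app _ _ _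
  | B2 x y =>
    refine .ext₂ fun a b => ?_
    refine ((BetaEta.B_app _ _ _).trans (.B_app _ _ _)).trans (.symm ?_)
    exact (BetaEta.app (.B_app _ _ _) (.refl _)).trans
      ((BetaEta.B_app _ _ _).trans (.app (.refl _) (.B_app _ _ _)))
  | B3 x =>
    refine .ext₃ fun a b c => ?_
    refine BetaEta.trans (.app (.app (.B_app _ _ _) (.refl _)) (.refl _)) ?_
    refine ((BetaEta.B_app _ _ _).trans (.B_app _ _ _)).trans (.symm ?_)
    refine BetaEta.trans (.app (.app (.B_app _ _ _) (.refl _)) (.refl _)) ?_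
    refine BetaEta.trans (.app (.B_app _ _ _) (.refl _)) ?_
    exact (BetaEta.B_app _ _ _).trans (.app (.refl _) (.B_app _ _ _))
  | refl e => exact .refl _
  | symm _ ih => exact .symm ih
  | trans _ _ ih₁ ih₂ => exact .trans ih₁ ih₂
  | app _ _ ih₁ ih₂ => exact .app ih₁ ih₂

/-! ### Normal forms acting on argument sequences -/

open Lam in
-- Each argument uses up one outer `B` by (B1) and is passed to `h`.
theorem spine_mono (j i : ℕ) (h : Lam) (s : ℕ → Lam) :
    BetaEta (spine (.app (mono (j + i)).toLam h) s i) (.app (mono j).toLam (spine h s i)) := by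
  induction i generalizing j with
  | zero => exact .refl _
  | succ i ih =>
    rw [show j + (i + 1) = j + 1 + i by omega]
    exact ((ih (j + 1)).app (.refl _)).trans (.B_app _ _ _)

open Lam in
theorem spine_mono_merge (n N : ℕ) (h : Lam) (s : ℕ → Lam) :
    BetaEta (spine (.app (mono n).toLam h) s (n + 1 + N + 1))
      (spine h (merge n s) (n + 1 + N)) := by
  induction N with
  | zero =>
    have e := spine_mono 0 n h s
    rw [Nat.zero_add] at e
    have e' : spine h (merge n s) (n + 1 + 0)
        = .app (spine h s n) (.app (s n) (s (n + 1))) := by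
      rw [Nat.add_zero, spine, merge_self, spine_congr_seq h fun i hi => merge_of_lt hi s]
    rw [e']
    exact ((e.app (.refl _)).app (.refl _)).trans (.B_app _ _ _)
  | succ N ih =>
    rw [← Nat.add_assoc, spine, spine.eq_2 h, merge_of_gt (by omega)]
    exact ih.app (.refl _)

open Lam in
theorem spine_comp (x y : BTerm) (h : Lam) (s : ℕ → Lam) (N : ℕ) :
    BetaEta (spine (.app (comp x y).toLam h) s N) (spine (.app x.toLam (.app y.toLam h)) s N) :=
  spine_congr (.B_app _ _ _) s N

open Lam in
/-- Applied to enough arguments, a polynomial merges them. -/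
theorem exists_spine_poly (n : ℕ) (l : List ℕ) :
    ∃ K, ∀ N ≥ K, ∀ (h : Lam) (s : ℕ → Lam),
      BetaEta (spine (.app (poly n l).toLam h) s (N + l.length + 1))
        (spine h (mergeList (n :: l) s) N) := by
  have base {N : ℕ} (m : ℕ) (hN : m + 1 ≤ N) (h : Lam) (s : ℕ → Lam) :
      BetaEta (spine (.app (mono m).toLam h) s (N + 1)) (spine h (merge m s) N) := by
    obtain ⟨k, rfl⟩ := Nat.exists_eq_add_of_le hN
    exact spine_mono_merge m k h s
  induction l generalizing n with
  | nil => exact ⟨n + 1, fun N hN h s => base n hN h s⟩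
  | cons m l ih =>
    obtain ⟨K, hK⟩ := ih m
    refine ⟨max K (n + 1), fun N hN h s => ?_⟩
    -- The outer factor `mono n` merges first, with `poly m l` applied to `h` as its head; this
    -- matches the order in `mergeList`.
    exact (spine_comp _ _ h s _).trans
      ((base n (by simp only [List.length_cons]; omega) _ s).trans (hK N (by omega) h _))

open Lam in
theorem poly_injective {n n' : ℕ} {l l' : List ℕ} (hl : (n :: l).Pairwise (· ≥ ·))
    (hl' : (n' :: l').Pairwise (· ≥ ·)) (h : Equivalent (poly n l) (poly n' l')) :
    n = n' ∧ l = l' := by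
  obtain ⟨K, hK⟩ := exists_spine_poly n l
  obtain ⟨K', hK'⟩ := exists_spine_poly n' l'
  have hfree : ∀ i, Free (var i) := fun _ => trivial
  rw [← List.cons.injEq]
  refine mergeList_var_injective hl hl' (funext fun i => ?_)
  -- Each merge uses up one argument, so the other list's length is added to equalize the totals; `i
  -- + 1` keeps position `i` within the result.
  have h₁ := hK (K + K' + l'.length + i + 1) (by omega) (var 0) var
  have h₂ := hK' (K + K' + l.length + i + 1) (by omega) (var 0) var
  rw [show K + K' + l.length + i + 1 + l'.length + 1
    = K + K' + l'.length + i + 1 + l.length + 1 by omega] at h₂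
  have h₃ := (h₁.symm.trans (spine_congr (h.app (.refl _)) var _)).trans h₂
  exact (spine_var_injective (h₃.eq_of_free (spine_free (hfree 0) (mergeList_free _ hfree) _)
    (spine_free (hfree 0) (mergeList_free _ hfree) _))).2 i (by omega)

theorem Equivalent.derivable {e f : BTerm} (h : Equivalent e f) : Derivable e f := by
  obtain ⟨n, l, hl, hd⟩ := hasNormalForm e
  obtain ⟨n', l', hl', hd'⟩ := hasNormalForm f
  obtain ⟨rfl, rfl⟩ := poly_injective hl hl'
    (hd.equivalent.symm.trans (Lam.BetaEta.trans h hd'.equivalent))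
  exact hd.trans hd'.symm

end BTerm

theorem mainTheorem2 (e₁ e₂ : BTerm) :
    BTerm.Equivalent e₁ e₂ ↔ BTerm.Derivable e₁ e₂ :=
  ⟨BTerm.Equivalent.derivable, BTerm.Derivable.equivalent⟩
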